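/- A \emph{PostPCA} (postselecting realtime probabilistic one-counter automaton) over the input alphabet $\Sigma$ consists of a finite state set $S$, an initial state $s_I$, two distinct states $s_{pa}, s_{pr}\in S$ (postselecting accepting and rejecting states), and an arbitrary real-valued transition function $$\delta : S\times(\Sigma\cup\{\mathrm{c},\$\})\times\{\text{zero},\text{nonzero}\}\times S\times\{-1,0,1\}\to[0,1],$$ where $\mathrm{c}$ and $\$$ are the left and right end-markers, not in $\Sigma$, such that $\sum_{s',d}\delta(s,\sigma,z,s',d)=1$ for all $s,\sigma,z$. On input $w\in\Sigma^*$ it starts in state $s_I$ with counter value $0$ and reads the word $\mathrm{c}\,w\,\$$ from left to right, one symbol per step; in state $s$, reading $\sigma$, with zero/nonzero status $z$ of the integer counter, it switches to state $s'$ and adds $d$ to the counter with probability $\delta(s,\sigma,z,s',d)$. Let $a(w)$ and $r(w)$ be the probabilities of being in $s_{pa}$ and in $s_{pr}$, respectively, after the whole word has been read. A PostPCA recognizes $L\subseteq\Sigma^*$ \emph{with bounded error} if there is $\varepsilon\in[0,\tfrac12)$ such that, for every $w\in\Sigma^*$, $a(w)+r(w)>0$, and $$\frac{a(w)}{a(w)+r(w)}\ge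 1-\varepsilon \text{ if } w\in L,\qquad \frac{r(w)}{a(w)+r(w)}\ge 1-\varepsilon\text{ if } w\notin L .$$ It runs \emph{in space} $f(n)$ if, for every $n$ and every input of length $n$, the absolute value of the counter never exceeds $f(n)$ on any computation path of non-zero probability. \textbf{Corollary.} For every space bound $f:\mathbb{N}\to\mathbb{N}$ that is not bounded by a constant, however slowly it grows, uncountably many languages $L\subseteq\{0,1\}^*$ are recognized with bounded error by PostPCAs running in space $f(n)$. -/

import Mathlib

/-- The symbols of the tape `¢ w $`: input symbols and the two end-markers. -/
inductive TapeSym (α : Type) where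
  | left : TapeSym α
  | sym : α → TapeSym α
  | right : TapeSym α

/-- The word `¢ w $` that is actually read on input `w`. -/
def tape {α : Type} (w : List α) : List (TapeSym α) :=
  TapeSym.left :: (w.map TapeSym.sym ++ [TapeSym.right])

/-- A postselecting realtime probabilistic one-counter automaton with input alphabet `α`
and finite state set `S`, with arbitrary real transition probabilities.

`δ s a z s' d` is the probability, when in state `s`, reading the tape symbol `a`, with counter
status `z` (`true` when the counter value is zero), of switching to state `s'` and adding
`d ∈ {-1, 0, 1}` to the integer counter. -/
structure PostPCA (α S : Type) [Fintype S] where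
  δ : S → TapeSym α → Bool → S → SignType → ℝ
  /-- the initial state -/
  sI : S
  /-- the postselecting accepting state -/
  spa : S
  /-- the postselecting rejecting state -/
  spr : S
  spa_ne_spr : spa ≠ spr
  δ_nonneg : ∀ s a z s' d, 0 ≤ δ s a z s' d
  δ_sum : ∀ s a z, ∑ s' : S, ∑ d : SignType, δ s a z s' d = 1

namespace PostPCA

variable {α S : Type} [Fintype S]

/-- The probability that the computation started in state `s` with counter value `c` is in state
`t` (with any counter value) after reading the given tape symbols, one symbol per step. -/
def endProb [DecidableEq S] (P : PostPCA α S) : List (TapeSym α) → S → ℤ → S → ℝ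
  | [], s, _, t => if s = t then 1 else 0
  | a :: u, s, c, t =>
      ∑ s' : S, ∑ d : SignType, P.δ s a (decide (c = 0)) s' d * endProb P u s' (c + (d : ℤ)) t

/-- The probability of ending in the postselecting accepting state on input `w`. -/
def accWeight [DecidableEq S] (P : PostPCA α S) (w : List α) : ℝ :=
  P.endProb (tape w) P.sI 0 P.spa

/-- The probability of ending in the postselecting rejecting state on input `w`. -/
def rejWeight [DecidableEq S] (P : PostPCA α S) (w : List α) : ℝ :=
  P.endProb (tape w) P.sI 0 P.spr

/-- The language `L` is recognized by `P` with error bound `ε`: on every input postselection is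
possible, members are accepted and non-members are rejected with (normalized) probability at
least `1 - ε`. -/
def Recognizes [DecidableEq S] (P : PostPCA α S) (L : Language α) (ε : ℝ) : Prop :=
  ∀ w : List α,
    0 < P.accWeight w + P.rejWeight w ∧
    (w ∈ L → 1 - ε ≤ P.accWeight w / (P.accWeight w + P.rejWeight w)) ∧
    (w ∉ L → 1 - ε ≤ P.rejWeight w / (P.accWeight w + P.rejWeight w))

/-- `P.Reach u s c`: after reading the tape symbols `u` from the initial configuration, `P` is in
state `s` with counter value `c` with non-zero probability. -/
inductive Reach (P : PostPCA α S) : List (TapeSym α) → S → ℤ → Prop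
  | init : Reach P [] P.sI 0
  | step {u : List (TapeSym α)} {s : S} {c : ℤ} (a : TapeSym α) (s' : S) (d : SignType) :
      Reach P u s c → 0 < P.δ s a (decide (c = 0)) s' d → Reach P (u ++ [a]) s' (c + (d : ℤ))

/-- `P` runs in space `f`: on every input `w`, the absolute value of the counter is at most
`f |w|` at every point of every computation path of non-zero probability. -/
def InSpace (P : PostPCA α S) (f : ℕ → ℕ) : Prop :=
  ∀ (w : List α) (u : List (TapeSym α)) (s : S) (c : ℤ),
    u <+: tape w → P.Reach u s c → |c| ≤ (f w.length : ℤ)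

end PostPCA

/-- `L` is recognized by a bounded-error PostPCA in space `f`. -/
def RecognizedByPostPCAInSpace {α : Type} (L : Language α) (f : ℕ → ℕ) : Prop :=
  ∃ (S : Type) (_ : Fintype S) (_ : DecidableEq S) (P : PostPCA α S) (ε : ℝ),
    0 ≤ ε ∧ ε < 1 / 2 ∧ P.Recognizes L ε ∧ P.InSpace f

/-!
Uncountably many languages are recognized by automata that never move the counter, so they run in
space `f` for every `f`.

Postselection only sees the ratio `ρ w` of the rejecting to the accepting probability. An arbitrary
weighted automaton with nonnegative real weights can be scaled down to a substochastic one and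
completed by an absorbing state; the scaling multiplies both probabilities by the same power. Hence
every function `ρ` computed by a weighted automaton (`IsNonnegRational`) occurs as such a ratio,
and if its values avoid the interval between `1/2` and `2`, then `{w | ρ w ≤ 1/2}` is recognized
with bounded error (`IsNonnegRational.recognized`).

For a real number `θ` and a word `w = 0^j 1 0^{n₀} 1 0^{n₁} 1 ⋯ 1 0^{nₖ}`, take
`ρ w = 1/4 * cosh (18 (n₀ - 4 n₁)) * ⋯ * cosh (18 (nₖ₋₁ - 4 nₖ)) * cosh (18 (nₖ - 1))
  + exp (18 (j - θ n₀))`,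
and `ρ w = 0` if `w` contains no `1`.
Expanding each `cosh` into two exponentials, one of which the automaton guesses, shows that `ρ` is
computed by a weighted automaton (`isNonnegRational_rejectionRatio`). The product is `1` if
`n₀ = 4^k, …, nₖ = 1`, and at least `8` otherwise, as some integer argument is then non-zero
(`headPenalty_dichotomy`). On the words that pass this check, the last summand compares `j` with
`θ 4^k`, and it is far from `1` if no `θ 4^k` is close to an integer (`rejectionRatio_gap`). This
holds for the uncountably many `θ` whose base-4 digits are all `1` or `2`
(`third_le_abs_sub_digitSlope`), and different `θ` give different languages, because an integer
`j` lies between `θ 4^k` and `θ' 4^k` for large `k` (`slopeLanguage_injective`).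
-/

noncomputable section

/-! ### Weighted automata as postselecting automata -/

/-- The total weight of the paths labelled `u` from `s` to `t` in the weighted graph `W`. -/
def pathWeight {A T : Type} [Fintype T] [DecidableEq T] (W : T → A → T → ℝ) :
    List A → T → T → ℝ
  | [], s, t => if s = t then 1 else 0
  | a :: u, s, t => ∑ s' : T, W s a s' * pathWeight W u s' t

/-- The automaton that never moves its counter, has the transition probabilities `κ * W` on the
states `some t`, and sends the missing probability to the absorbing state `none`. -/
def stochasticCompletion {α T : Type} [Fintype T] (W : T → TapeSym α → T → ℝ) (κ : ℝ)
    (hW : ∀ s a t, 0 ≤ W s a t) (hκ : 0 ≤ κ) (hsum : ∀ s a, κ * ∑ t, W s a t ≤ 1)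
    (i p q : T) (hpq : p ≠ q) : PostPCA α (Option T) where
  δ s a _ s' d := if d = 0 then
      match s, s' with
      | none, none => 1
      | none, some _ => 0
      | some t, none => 1 - κ * ∑ t', W t a t'
      | some t, some t' => κ * W t a t'
    else 0
  sI := some i
  spa := some p
  spr := some q
  spa_ne_spr := by simpa using hpq
  δ_nonneg s a z s' d := by
    split_ifs
    · rcases s with _ | s <;> rcases s' with _ | s' <;> simp only [le_refl, zero_le_one]
      · linarith [hsum s a]
      · exact mul_nonneg hκ (hW _ _ _)
    · exact le_rfl
  δ_sum s a z := by
    simp only [Finset.sum_ite_eq', Finset.mem_univ, if_true, Fintype.sum_option]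
    rcases s with _ | s
    · simp
    · simp [Finset.mul_sum]

section Completion

variable {α T : Type} [Fintype T] {W : T → TapeSym α → T → ℝ} {κ : ℝ}
  {hW : ∀ s a t, 0 ≤ W s a t} {hκ : 0 ≤ κ} {hsum : ∀ s a, κ * ∑ t, W s a t ≤ 1}
  {i p q : T} {hpq : p ≠ q}

theorem stochasticCompletion_endProb_none [DecidableEq T] (u : List (TapeSym α)) (c : ℤ) (t : T) :
    (stochasticCompletion W κ hW hκ hsum i p q hpq).endProb u none c (some t) = 0 := by
  induction u generalizing c with
  | nil => simp [PostPCA.endProb]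
  | cons a u ih =>
    rw [PostPCA.endProb]
    refine Finset.sum_eq_zero fun s' _ => Finset.sum_eq_zero fun d _ => ?_
    rcases s' with _ | s'
    · rw [ih, mul_zero]
    · simp [stochasticCompletion]

theorem stochasticCompletion_endProb [DecidableEq T] (u : List (TapeSym α)) (s : T) (c : ℤ)
    (t : T) :
    (stochasticCompletion W κ hW hκ hsum i p q hpq).endProb u (some s) c (some t) =
      κ ^ u.length * pathWeight W u s t := by
  induction u generalizing s c with
  | nil => simp [PostPCA.endProb, pathWeight]
  | cons a u ih =>
    rw [PostPCA.endProb, Fintype.sum_option]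
    simp only [stochasticCompletion_endProb_none, ih, mul_zero, Finset.sum_const_zero, zero_add]
    simp only [stochasticCompletion, ite_mul, zero_mul, Finset.sum_ite_eq', Finset.mem_univ,
      if_true, pathWeight, Finset.mul_sum, List.length_cons, pow_succ]
    exact Finset.sum_congr rfl fun _ _ => by ring

theorem stochasticCompletion_counter_eq_zero {u : List (TapeSym α)} {s : Option T} {c : ℤ}
    (h : (stochasticCompletion W κ hW hκ hsum i p q hpq).Reach u s c) : c = 0 := by
  induction h with
  | init => rfl
  | step a s' d _ hpos ih =>
    have hd : d = 0 := by
      by_contra hd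
      simp [stochasticCompletion, hd] at hpos
    simp [ih, hd]

end Completion

/-- A function `ρ` on words is nonnegatively rational if it is computed by a finite weighted
automaton with nonnegative real weights. The automaton is given by the functions `g s` computed
from its states `s`: reading a letter turns each of them into a nonnegative combination of the
others, and `ρ` itself is such a combination. -/
def IsNonnegRational (ρ : List Bool → ℝ) : Prop :=
  ∃ (S : Type) (_ : Fintype S) (M : S → Bool → S → ℝ) (π : S → ℝ) (g : S → List Bool → ℝ),
    (∀ s b t, 0 ≤ M s b t) ∧ (∀ s, 0 ≤ π s) ∧ (∀ s, 0 ≤ g s []) ∧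
    (∀ s b w, g s (b :: w) = ∑ t, M s b t * g t w) ∧ ∀ w, ρ w = ∑ s, π s * g s w

/-- The edge weights of an automaton that has total weight `1` of going from `inr 0` to `inr 2`
on every input, and total weight `∑ s, π s * g s w` of going from `inr 0` to `inr 3` on input `w`,
when `g` is the family of functions computed by `M` with final weights `η`. -/
def comparisonWeight {S : Type} (M : S → Bool → S → ℝ) (π η : S → ℝ) :
    S ⊕ Fin 4 → TapeSym Bool → S ⊕ Fin 4 → ℝ
  | .inr 0, .left, .inl s => π s
  | .inr 0, .left, .inr 1 => 1
  | .inr 1, .sym _, .inr 1 => 1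
  | .inr 1, .right, .inr 2 => 1
  | .inl s, .sym b, .inl t => M s b t
  | .inl s, .right, .inr 3 => η s
  | _, _, _ => 0

theorem comparisonWeight_nonneg {S : Type} {M : S → Bool → S → ℝ} {π η : S → ℝ}
    (hM : ∀ s b t, 0 ≤ M s b t) (hπ : ∀ s, 0 ≤ π s) (hη : ∀ s, 0 ≤ η s) (s a t) :
    0 ≤ comparisonWeight M π η s a t := by
  unfold comparisonWeight
  split <;> first | exact hM _ _ _ | exact hπ _ | exact hη _ | norm_num

section Comparison

variable {S : Type} [Fintype S] [DecidableEq S] {M : S → Bool → S → ℝ} {π η : S → ℝ}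

theorem pathWeight_comparison_one (w : List Bool) :
    pathWeight (comparisonWeight M π η) (w.map .sym ++ [.right]) (.inr 1) (.inr 2) = 1 := by
  induction w with
  | nil => simp [pathWeight, comparisonWeight]
  | cons b w ih => simp [pathWeight, comparisonWeight, Fin.sum_univ_four] at ih ⊢; exact ih

theorem pathWeight_comparison_one_rej (w : List Bool) :
    pathWeight (comparisonWeight M π η) (w.map .sym ++ [.right]) (.inr 1) (.inr 3) = 0 := by
  induction w with
  | nil => simp [pathWeight, comparisonWeight]
  | cons b w ih => simp [pathWeight, comparisonWeight, Fin.sum_univ_four] at ih ⊢; exact ih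

theorem pathWeight_comparison_run_acc (w : List Bool) (s : S) :
    pathWeight (comparisonWeight M π η) (w.map .sym ++ [.right]) (.inl s) (.inr 2) = 0 := by
  induction w generalizing s with
  | nil => simp [pathWeight, comparisonWeight]
  | cons b w ih => simp [pathWeight, comparisonWeight] at ih ⊢; simp [ih]

theorem pathWeight_comparison_run_rej {g : S → List Bool → ℝ} (hη : ∀ s, g s [] = η s)
    (hg : ∀ s b w, g s (b :: w) = ∑ t, M s b t * g t w) (w : List Bool) (s : S) :
    pathWeight (comparisonWeight M π η) (w.map .sym ++ [.right]) (.inl s) (.inr 3) = g s w := by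
  induction w generalizing s with
  | nil => simp [pathWeight, comparisonWeight, hη]
  | cons b w ih =>
    simp [pathWeight, comparisonWeight] at ih ⊢; simp [ih, hg]

theorem pathWeight_comparison_acc (w : List Bool) :
    pathWeight (comparisonWeight M π η) (tape w) (.inr 0) (.inr 2) = 1 := by
  rw [tape, pathWeight, Fintype.sum_sum_type]
  simp [comparisonWeight, Fin.sum_univ_four, pathWeight_comparison_run_acc,
    pathWeight_comparison_one]

theorem pathWeight_comparison_rej {g : S → List Bool → ℝ} (hη : ∀ s, g s [] = η s)
    (hg : ∀ s b w, g s (b :: w) = ∑ t, M s b t * g t w) (w : List Bool) :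
    pathWeight (comparisonWeight M π η) (tape w) (.inr 0) (.inr 3) = ∑ s, π s * g s w := by
  rw [tape, pathWeight, Fintype.sum_sum_type]
  simp [comparisonWeight, Fin.sum_univ_four, pathWeight_comparison_run_rej hη hg,
    pathWeight_comparison_one_rej]

end Comparison

/-- Scaling all weights of a weighted automaton by the same factor multiplies every path weight on
a given input by the same number, which postselection cancels. So the ratio of the rejecting to
the accepting probability can be any nonnegatively rational function. -/
theorem IsNonnegRational.recognized {ρ : List Bool → ℝ} (hρ : IsNonnegRational ρ)
    (gap : ∀ w, ρ w ≤ 1 / 2 ∨ 2 ≤ ρ w) (f : ℕ → ℕ) :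
    RecognizedByPostPCAInSpace ({w | ρ w ≤ 1 / 2} : Set (List Bool)) f := by
  classical
  obtain ⟨S, _, M, π, g, hM, hπ, hη, hg, hρ⟩ := hρ
  set W := comparisonWeight M π (fun s => g s [])
  have hW : ∀ s a t, 0 ≤ W s a t := comparisonWeight_nonneg hM hπ hη
  -- `V` adds up the weights over all tape symbols, and the sum `K` of its entries bounds every row
  -- sum of `W`.
  set V : S ⊕ Fin 4 → S ⊕ Fin 4 → ℝ := fun s t =>
    W s .left t + W s .right t + W s (.sym true) t + W s (.sym false) t with hVdef
  have hWV : ∀ s a t, W s a t ≤ V s t := by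
    intro s a t
    have h1 := hW s .left t
    have h2 := hW s .right t
    have h3 := hW s (.sym true) t
    have h4 := hW s (.sym false) t
    simp only [hVdef]
    rcases a with _ | (_ | _) | _ <;> linarith
  have hV : ∀ s t, 0 ≤ V s t := fun s t => (hW s .left t).trans (hWV s .left t)
  have hrows : ∀ s, 0 ≤ ∑ t, V s t := fun s => Finset.sum_nonneg fun t _ => hV s t
  set K : ℝ := 1 + ∑ s, ∑ t, V s t
  have hrow : ∀ s a, ∑ t, W s a t ≤ K := by
    intro s a
    have h1 : ∑ t, W s a t ≤ ∑ t, V s t := Finset.sum_le_sum fun t _ => hWV s a t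
    have h2 : ∑ t, V s t ≤ ∑ s, ∑ t, V s t :=
      Finset.single_le_sum (f := fun s => ∑ t, V s t) (fun s _ => hrows s) (Finset.mem_univ s)
    linarith
  have hKpos : 0 < K := by
    have : 0 ≤ ∑ s, ∑ t, V s t := Finset.sum_nonneg fun s _ => hrows s
    linarith
  have hκ : (0 : ℝ) < K⁻¹ := inv_pos.mpr hKpos
  have hsum : ∀ s a, K⁻¹ * ∑ t, W s a t ≤ 1 := fun s a => by
    rw [inv_mul_le_iff₀ hKpos, mul_one]; exact hrow s a
  set P := stochasticCompletion W K⁻¹ hW hκ.le hsum (.inr 0) (.inr 2) (.inr 3) (by simp)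
  refine ⟨Option (S ⊕ Fin 4), inferInstance, inferInstance, P, 1 / 3, by norm_num, by norm_num,
    fun w => ?_, fun w u s c _ h => ?_⟩
  · have hacc : P.accWeight w = K⁻¹ ^ (tape w).length := by
      have := stochasticCompletion_endProb (hW := hW) (hκ := hκ.le) (hsum := hsum) (i := .inr 0)
        (p := .inr 2) (q := .inr 3) (hpq := by simp) (tape w) (.inr 0) 0 (.inr 2)
      rw [pathWeight_comparison_acc, mul_one] at this
      exact this
    have hrej : P.rejWeight w = K⁻¹ ^ (tape w).length * ρ w := by
      have := stochasticCompletion_endProb (hW := hW) (hκ := hκ.le) (hsum := hsum) (i := .inr 0)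
        (p := .inr 2) (q := .inr 3) (hpq := by simp) (tape w) (.inr 0) 0 (.inr 3)
      rw [pathWeight_comparison_rej (fun _ => rfl) hg, ← hρ] at this
      exact this
    have hpow : 0 < K⁻¹ ^ (tape w).length := pow_pos hκ _
    have hg0 : ∀ s (v : List Bool), 0 ≤ g s v := by
      intro s v
      induction v generalizing s with
      | nil => exact hη s
      | cons b v ih =>
        rw [hg]; exact Finset.sum_nonneg fun t _ => mul_nonneg (hM _ _ _) (ih t)
    have hρ0 : 0 ≤ ρ w := by
      rw [hρ]; exact Finset.sum_nonneg fun s _ => mul_nonneg (hπ s) (hg0 s w)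
    have hadd : P.accWeight w + P.rejWeight w = K⁻¹ ^ (tape w).length * (1 + ρ w) := by
      rw [hacc, hrej]; ring
    have hpos : 0 < P.accWeight w + P.rejWeight w := by rw [hadd]; positivity
    refine ⟨hpos, fun h => ?_, fun h => ?_⟩
    · have h : ρ w ≤ 1 / 2 := h
      rw [le_div_iff₀ hpos, hadd, hacc]
      nlinarith
    · have h : 2 ≤ ρ w := (gap w).resolve_left h
      rw [le_div_iff₀ hpos, hadd, hrej]
      nlinarith
  · rw [stochasticCompletion_counter_eq_zero h]
    simp

/-! ### Closure properties of nonnegatively rational functions -/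

theorem IsNonnegRational.one : IsNonnegRational fun _ => 1 :=
  ⟨Unit, inferInstance, fun _ _ _ => 1, fun _ => 1, fun _ _ => 1, by simp⟩

theorem IsNonnegRational.add {ρ σ : List Bool → ℝ} (hρ : IsNonnegRational ρ)
    (hσ : IsNonnegRational σ) : IsNonnegRational fun w => ρ w + σ w := by
  obtain ⟨S, _, M, π, g, hM, hπ, hη, hg, hρ⟩ := hρ
  obtain ⟨S', _, M', π', g', hM', hπ', hη', hg', hσ⟩ := hσ
  refine ⟨S ⊕ S', inferInstance,
    fun s b t => Sum.elim (fun s => Sum.elim (M s b) (fun _ => 0) t)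
      (fun s => Sum.elim (fun _ => 0) (M' s b) t) s,
    Sum.elim π π', Sum.elim g g', ?_, ?_, ?_, ?_, ?_⟩
  · rintro (s | s) b (t | t) <;> simp [hM, hM']
  · rintro (s | s) <;> simp [hπ, hπ']
  · rintro (s | s) <;> simp [hη, hη']
  · rintro (s | s) b w <;> simp [hg, hg']
  · intro w; simp [hρ, hσ]

theorem IsNonnegRational.const_mul {ρ : List Bool → ℝ} (hρ : IsNonnegRational ρ) {c : ℝ}
    (hc : 0 ≤ c) : IsNonnegRational fun w => c * ρ w := by
  obtain ⟨S, _, M, π, g, hM, hπ, hη, hg, hρ⟩ := hρ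
  exact ⟨S, inferInstance, M, fun s => c * π s, g, hM, fun s => mul_nonneg hc (hπ s), hη, hg,
    fun w => by simp [hρ, Finset.mul_sum, mul_assoc]⟩

/-- A new state with a loop on the letter `false`, left by the letter `true`. -/
theorem IsNonnegRational.of_loop {ρ ψ : List Bool → ℝ} (hψ : IsNonnegRational ψ) {c : ℝ}
    (hc : 0 ≤ c) (h0 : 0 ≤ ρ []) (hfalse : ∀ w, ρ (false :: w) = c * ρ w)
    (htrue : ∀ w, ρ (true :: w) = ψ w) : IsNonnegRational ρ := by
  obtain ⟨S, _, M, π, g, hM, hπ, hη, hg, hψ⟩ := hψ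
  refine ⟨Option S, inferInstance,
    fun s b t => s.elim (if b then t.elim 0 π else t.elim c fun _ => 0)
      fun s => t.elim 0 (M s b),
    fun s => s.elim 1 fun _ => 0, fun s => s.elim ρ g, ?_, ?_, ?_, ?_, ?_⟩
  · rintro (_ | s) (_ | _) (_ | t) <;> simp [hM, hπ, hc]
  · rintro (_ | s) <;> simp
  · rintro (_ | s) <;> simp [hη, h0]
  · rintro (_ | s) (_ | _) w <;> simp [hg, hfalse, htrue, hψ, Fintype.sum_option]
  · intro w; simp [Fintype.sum_option]

/-! ### Checking that consecutive blocks shrink by a factor of four -/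

/-- For `w = 0^n 1 0^{m₁} 1 ⋯ 1 0^{mₖ}`, the product of `cosh (18 x)` over `x = d - 4 n`,
`x = (b + n) - 4 m₁`, `x = m₁ - 4 m₂`, …, `x = mₖ - 1` (only `x = d - 4 n` and `x = (b + n) - 1`
if `k = 0`). Here `b` is the part already read of the current block, and `d` is the length of the
preceding block minus `4 b`. The factor `18` makes `cosh (18 x)` at least `8` at non-zero
integers. -/
def chainPenalty : ℤ → ℤ → List Bool → ℝ
  | d, b, [] => Real.cosh (18 * d) * Real.cosh (18 * (b - 1))
  | d, b, false :: w => chainPenalty (d - 4) (b + 1) w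
  | d, b, true :: w => Real.cosh (18 * d) * chainPenalty b 0 w

/-- The product `chainPenalty` without its first factor, as the first block of a chain has no
predecessor. -/
def headPenalty : ℤ → List Bool → ℝ
  | b, [] => Real.cosh (18 * (b - 1))
  | b, false :: w => headPenalty (b + 1) w
  | b, true :: w => chainPenalty b 0 w

/-- The sign `1` (for `true`) or `-1` (for `false`) of one of the two exponentials
that make up a hyperbolic cosine. -/
def boolSign (s : Bool) : ℝ := if s then 1 else -1

/-- The coefficients of `chainPenalty d b w` as a combination of the exponentials
`exp (18 (± d ± b))`. -/
def chainCoeff : List Bool → Bool → Bool → ℝ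
  | [], _, s' => 1 / 4 * Real.exp (-18 * boolSign s')
  | false :: w, s, s' => Real.exp (18 * (boolSign s' - 4 * boolSign s)) * chainCoeff w s s'
  | true :: w, _, s' => 1 / 2 * ∑ s'', chainCoeff w s' s''

/-- The coefficients of `headPenalty b w` as a combination of the exponentials `exp (± 18 b)`. -/
def headCoeff (s : Bool) : List Bool → ℝ
  | [] => 1 / 2 * Real.exp (-18 * boolSign s)
  | false :: w => Real.exp (18 * boolSign s) * headCoeff s w
  | true :: w => ∑ s', chainCoeff w s s'

theorem chainPenalty_eq (d b : ℤ) (w : List Bool) :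
    chainPenalty d b w =
      ∑ s, ∑ s', Real.exp (18 * (boolSign s * d + boolSign s' * b)) * chainCoeff w s s' := by
  induction w generalizing d b with
  | nil =>
    simp only [chainPenalty, chainCoeff, Real.cosh_eq, Fintype.sum_bool, boolSign]
    simp only [if_true, Bool.false_eq_true, if_false, mul_left_comm (Real.exp _) (1 / 4 : ℝ),
      ← Real.exp_add]
    rw [div_mul_div_comm, add_mul, mul_add, mul_add]
    simp only [← Real.exp_add]
    ring_nf
  | cons c w ih =>
    cases c
    · simp only [chainPenalty, chainCoeff, ih, ← mul_assoc, ← Real.exp_add]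
      refine Finset.sum_congr rfl fun s _ => Finset.sum_congr rfl fun s' _ => ?_
      congr 2
      push_cast
      ring
    · simp only [chainPenalty, chainCoeff, ih, Real.cosh_eq, Fintype.sum_bool, boolSign]
      simp only [if_true, Bool.false_eq_true, if_false, mul_add, Real.exp_add, Int.cast_zero,
        mul_zero, Real.exp_zero, mul_one, neg_mul, one_mul, mul_neg]
      ring

theorem headPenalty_eq (b : ℤ) (w : List Bool) :
    headPenalty b w = ∑ s, Real.exp (18 * (boolSign s * b)) * headCoeff s w := by
  induction w generalizing b with
  | nil =>
    simp only [headPenalty, headCoeff, Real.cosh_eq, Fintype.sum_bool, boolSign]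
    simp only [if_true, Bool.false_eq_true, if_false, mul_left_comm (Real.exp _) (1 / 2 : ℝ),
      ← Real.exp_add]
    ring_nf
  | cons c w ih =>
    cases c
    · simp only [headPenalty, headCoeff, ih, ← mul_assoc, ← Real.exp_add]
      refine Finset.sum_congr rfl fun s _ => ?_
      congr 2
      push_cast
      ring
    · simp [headPenalty, headCoeff, chainPenalty_eq, mul_add]

theorem isNonnegRational_sum_chainCoeff (s : Bool) :
    IsNonnegRational fun w => ∑ s', chainCoeff w s s' := by
  refine ⟨Bool × Bool, inferInstance,
    fun p c q => if c then (if q.1 = p.2 then 1 / 2 else 0)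
      else if q = p then Real.exp (18 * (boolSign p.2 - 4 * boolSign p.1)) else 0,
    fun p => if p.1 = s then 1 else 0, fun p w => chainCoeff w p.1 p.2, ?_, ?_, ?_, ?_, ?_⟩
  · intro p c q
    dsimp only
    split_ifs <;> positivity
  · intro p
    dsimp only
    split_ifs <;> norm_num
  · intro p
    simp only [chainCoeff]
    positivity
  · rintro p (_ | _) w
    · simp [chainCoeff]
    · simp [chainCoeff, Fintype.sum_prod_type, mul_add]
  · intro w
    simp [Fintype.sum_prod_type]

theorem isNonnegRational_headPenalty (b : ℤ) : IsNonnegRational (headPenalty b) := by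
  have h : ∀ s, IsNonnegRational (headCoeff s) := fun s =>
    (isNonnegRational_sum_chainCoeff s).of_loop (Real.exp_pos (18 * boolSign s)).le
      (by simp only [headCoeff]; positivity) (fun _ => rfl) fun _ => rfl
  have h2 := ((h true).const_mul (Real.exp_pos (18 * (boolSign true * b))).le).add
    ((h false).const_mul (Real.exp_pos (18 * (boolSign false * b))).le)
  convert h2 using 2 with w
  rw [headPenalty_eq, Fintype.sum_bool]

theorem eight_le_cosh {x : ℤ} (hx : x ≠ 0) : 8 ≤ Real.cosh (18 * x) := by
  have h1 : (1 : ℝ) ≤ |(x : ℝ)| := by exact_mod_cast Int.one_le_abs hx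
  have h2 := Real.add_one_le_exp (18 * |(x : ℝ)|)
  have h3 := Real.exp_pos (-(18 * |(x : ℝ)|))
  rw [← Real.cosh_abs, abs_mul, abs_of_pos (by norm_num : (0 : ℝ) < 18), Real.cosh_eq]
  linarith

/-- The number of leading `false`s. -/
def leadLength : List Bool → ℕ
  | false :: w => leadLength w + 1
  | _ => 0

theorem one_le_chainPenalty (d b : ℤ) (w : List Bool) : 1 ≤ chainPenalty d b w := by
  induction w generalizing d b with
  | nil => exact one_le_mul_of_one_le_of_one_le (Real.one_le_cosh _) (Real.one_le_cosh _)
  | cons c w ih =>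
    cases c
    · exact ih _ _
    · exact one_le_mul_of_one_le_of_one_le (Real.one_le_cosh _) (ih _ _)

/-- The product is `1` only if all the blocks fit together, which makes the current one a power of
four: the last block has length `1`, and each block is four times its successor. -/
theorem chainPenalty_dichotomy (d b : ℤ) (w : List Bool) :
    8 ≤ chainPenalty d b w ∨ chainPenalty d b w = 1 ∧ d = 4 * leadLength w ∧
      ∃ k : ℕ, b + leadLength w = 4 ^ k := by
  induction w generalizing d b with
  | nil =>
    by_cases hd : d = 0
    · by_cases hb : b = 1
      · subst hd hb
        exact Or.inr ⟨by simp [chainPenalty], by simp [leadLength], 0, by simp [leadLength]⟩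
      · have h := eight_le_cosh (sub_ne_zero.mpr hb)
        push_cast at h
        exact Or.inl (h.trans (le_mul_of_one_le_left (Real.cosh_pos _).le (Real.one_le_cosh _)))
    · exact Or.inl ((eight_le_cosh hd).trans
        (le_mul_of_one_le_right (Real.cosh_pos _).le (Real.one_le_cosh _)))
  | cons c w ih =>
    cases c
    · refine (ih (d - 4) (b + 1)).imp_right ?_
      rintro ⟨h1, h2, k, h3⟩
      refine ⟨h1, ?_, k, ?_⟩ <;> simp only [leadLength] <;> push_cast <;> linarith
    · by_cases hd : d = 0
      · subst hd
        have h : chainPenalty 0 b (true :: w) = chainPenalty b 0 w := by simp [chainPenalty]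
        rw [h]
        refine (ih b 0).imp_right ?_
        rintro ⟨h1, h2, k, h3⟩
        refine ⟨h1, by simp [leadLength], k + 1, ?_⟩
        simp only [leadLength, Nat.cast_zero, pow_succ]
        linarith
      · exact Or.inl ((eight_le_cosh hd).trans
          (le_mul_of_one_le_right (Real.cosh_pos _).le (one_le_chainPenalty _ _ _)))

theorem headPenalty_dichotomy (b : ℤ) (w : List Bool) :
    8 ≤ headPenalty b w ∨ headPenalty b w = 1 ∧ ∃ k : ℕ, b + leadLength w = 4 ^ k := by
  induction w generalizing b with
  | nil =>
    by_cases hb : b = 1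
    · subst hb
      exact Or.inr ⟨by simp [headPenalty], 0, by simp [leadLength]⟩
    · have h := eight_le_cosh (sub_ne_zero.mpr hb)
      push_cast at h
      exact Or.inl h
  | cons c w ih =>
    cases c
    · refine (ih (b + 1)).imp_right ?_
      rintro ⟨h1, k, h2⟩
      refine ⟨h1, k, ?_⟩
      simp only [leadLength]
      push_cast
      linarith
    · refine (chainPenalty_dichotomy b 0 w).imp_right ?_
      rintro ⟨h1, h2, k, h3⟩
      refine ⟨h1, k + 1, ?_⟩
      simp only [leadLength, Nat.cast_zero, pow_succ]
      linarith

/-- The word `0^{4^k} 1 0^{4^(k-1)} 1 ⋯ 1 0^4 1 0`. -/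
def powerChain : ℕ → List Bool
  | 0 => [false]
  | k + 1 => List.replicate (4 ^ (k + 1)) false ++ true :: powerChain k

theorem chainPenalty_replicate_append (n : ℕ) (d b : ℤ) (w : List Bool) :
    chainPenalty d b (List.replicate n false ++ w) = chainPenalty (d - 4 * n) (b + n) w := by
  induction n generalizing d b with
  | zero => simp
  | succ n ih =>
    rw [List.replicate_succ, List.cons_append, chainPenalty, ih]
    congr 1 <;> push_cast <;> ring

theorem headPenalty_replicate_append (n : ℕ) (b : ℤ) (w : List Bool) :
    headPenalty b (List.replicate n false ++ w) = headPenalty (b + n) w := by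
  induction n generalizing b with
  | zero => simp
  | succ n ih =>
    rw [List.replicate_succ, List.cons_append, headPenalty, ih]
    congr 1; push_cast; ring

theorem leadLength_replicate_append (n : ℕ) (w : List Bool) :
    leadLength (List.replicate n false ++ w) = n + leadLength w := by
  induction n with
  | zero => simp
  | succ n ih => rw [List.replicate_succ, List.cons_append, leadLength, ih]; ring

theorem leadLength_powerChain (k : ℕ) : leadLength (powerChain k) = 4 ^ k := by
  cases k with
  | zero => simp [powerChain, leadLength]
  | succ k => rw [powerChain, leadLength_replicate_append]; simp [leadLength]

theorem chainPenalty_powerChain (k : ℕ) : chainPenalty (4 ^ (k + 1)) 0 (powerChain k) = 1 := by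
  induction k with
  | zero => simp [powerChain, chainPenalty]
  | succ k ih =>
    rw [powerChain, chainPenalty_replicate_append, chainPenalty]
    have h : (4 : ℤ) ^ (k + 1 + 1) - 4 * ((4 ^ (k + 1) : ℕ) : ℤ) = 0 := by push_cast; ring
    rw [h]
    simpa using ih

theorem headPenalty_powerChain (k : ℕ) : headPenalty 0 (powerChain k) = 1 := by
  cases k with
  | zero => simp [powerChain, headPenalty]
  | succ k =>
    rw [powerChain, headPenalty_replicate_append, headPenalty]
    simpa using chainPenalty_powerChain k

/-! ### Comparing two blocks with a real slope -/

/-- `exp (-18 θ n)`, where `n` is the length of the first block. -/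
def slopeWeight (θ : ℝ) : List Bool → ℝ
  | false :: w => Real.exp (-18 * θ) * slopeWeight θ w
  | _ => 1

/-- `exp (18 (j - θ n))`, where `j` and `n` are the lengths of the first two blocks, and `0` if
there is only one block. -/
def comparisonRatio (θ : ℝ) : List Bool → ℝ
  | [] => 0
  | false :: w => Real.exp 18 * comparisonRatio θ w
  | true :: w => slopeWeight θ w

/-- `headPenalty` of the word without its first block, and `0` if there is only one block. -/
def tailPenalty : List Bool → ℝ
  | [] => 0
  | false :: w => tailPenalty w
  | true :: w => headPenalty 0 w

/-- The ratio of rejecting to accepting probability. The first summand is large unless the blocks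
after the first have lengths `4^k, …, 4, 1`; the second one compares the first block with `θ 4^k`.
-/
def rejectionRatio (θ : ℝ) (w : List Bool) : ℝ :=
  1 / 4 * tailPenalty w + comparisonRatio θ w

theorem isNonnegRational_rejectionRatio (θ : ℝ) : IsNonnegRational (rejectionRatio θ) := by
  have h1 : IsNonnegRational tailPenalty :=
    (isNonnegRational_headPenalty 0).of_loop zero_le_one le_rfl (fun _ => (one_mul _).symm)
      fun _ => rfl
  have h2 : IsNonnegRational (slopeWeight θ) :=
    IsNonnegRational.one.of_loop (Real.exp_pos (-18 * θ)).le zero_le_one (fun _ => rfl)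
      fun _ => rfl
  have h3 : IsNonnegRational (comparisonRatio θ) :=
    h2.of_loop (Real.exp_pos 18).le le_rfl (fun _ => rfl) fun _ => rfl
  exact (h1.const_mul (by norm_num)).add h3

theorem slopeWeight_eq (θ : ℝ) (w : List Bool) :
    slopeWeight θ w = Real.exp (-18 * θ * leadLength w) := by
  induction w with
  | nil => simp [slopeWeight, leadLength]
  | cons c w ih =>
    cases c
    · simp only [slopeWeight, leadLength, ih, ← Real.exp_add]
      push_cast
      ring_nf
    · simp [slopeWeight, leadLength]

theorem rejectionRatio_replicate (θ : ℝ) (j : ℕ) :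
    rejectionRatio θ (List.replicate j false) = 0 := by
  have h1 : tailPenalty (List.replicate j false) = 0 := by
    induction j with
    | zero => rfl
    | succ j ih => exact ih
  have h2 : comparisonRatio θ (List.replicate j false) = 0 := by
    clear h1
    induction j with
    | zero => rfl
    | succ j ih => rw [List.replicate_succ, comparisonRatio, ih, mul_zero]
  rw [rejectionRatio, h1, h2]; simp

theorem rejectionRatio_replicate_append (θ : ℝ) (j : ℕ) (w : List Bool) :
    rejectionRatio θ (List.replicate j false ++ true :: w) =
      1 / 4 * headPenalty 0 w + Real.exp (18 * (j - θ * leadLength w)) := by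
  have h1 : tailPenalty (List.replicate j false ++ true :: w) = headPenalty 0 w := by
    induction j with
    | zero => rfl
    | succ j ih => exact ih
  have h2 : comparisonRatio θ (List.replicate j false ++ true :: w) =
      Real.exp (18 * (j - θ * leadLength w)) := by
    clear h1
    induction j with
    | zero =>
      simp only [List.replicate_zero, List.nil_append, comparisonRatio, slopeWeight_eq]
      congr 1; push_cast; ring
    | succ j ih =>
      rw [List.replicate_succ, List.cons_append, comparisonRatio, ih, ← Real.exp_add]
      congr 1; push_cast; ring
  rw [rejectionRatio, h1, h2]

theorem exists_eq_replicate_append (w : List Bool) :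
    ∃ j, w = List.replicate j false ∨ ∃ v, w = List.replicate j false ++ true :: v := by
  induction w with
  | nil => exact ⟨0, Or.inl rfl⟩
  | cons c w ih =>
    cases c
    · obtain ⟨j, rfl | ⟨v, rfl⟩⟩ := ih
      · exact ⟨j + 1, Or.inl rfl⟩
      · exact ⟨j + 1, Or.inr ⟨v, rfl⟩⟩
    · exact ⟨0, Or.inr ⟨w, rfl⟩⟩

theorem exp_le_quarter {x : ℝ} (hx : x ≤ -(1 / 3)) : Real.exp (18 * x) ≤ 1 / 4 := by
  have h := Real.add_one_le_exp (-(18 * x))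
  rw [Real.exp_neg] at h
  rw [← inv_inv (Real.exp (18 * x)), one_div]
  exact inv_anti₀ (by norm_num) (by linarith)

theorem two_le_exp {x : ℝ} (hx : 1 / 3 ≤ x) : 2 ≤ Real.exp (18 * x) := by
  linarith [Real.add_one_le_exp (18 * x)]

/-- If no multiple `θ 4^k` is close to an integer, the error is bounded: a malformed word has a
large first summand, and on a well-formed one the second summand is far from `1`. -/
theorem rejectionRatio_gap {θ : ℝ} (hθ : ∀ k j : ℕ, 1 / 3 ≤ |(j : ℝ) - θ * 4 ^ k|)
    (w : List Bool) : rejectionRatio θ w ≤ 1 / 2 ∨ 2 ≤ rejectionRatio θ w := by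
  obtain ⟨j, rfl | ⟨v, rfl⟩⟩ := exists_eq_replicate_append w
  · rw [rejectionRatio_replicate]; norm_num
  · rw [rejectionRatio_replicate_append]
    rcases headPenalty_dichotomy 0 v with h | ⟨h, k, hk⟩
    · right
      linarith [Real.exp_pos (18 * (j - θ * leadLength v))]
    · have hk : (leadLength v : ℝ) = 4 ^ k := by rw [zero_add] at hk; exact_mod_cast hk
      rw [h, hk]
      rcases le_abs'.mp (hθ k j) with h | h
      · left; linarith [exp_le_quarter h]
      · right; linarith [two_le_exp h]

theorem rejectionRatio_powerChain (θ : ℝ) (j k : ℕ) :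
    rejectionRatio θ (List.replicate j false ++ true :: powerChain k) =
      1 / 4 + Real.exp (18 * (j - θ * 4 ^ k)) := by
  rw [rejectionRatio_replicate_append, headPenalty_powerChain, leadLength_powerChain]
  push_cast
  ring

theorem exists_rejectionRatio_lt {θ θ' : ℝ} (h0 : 0 ≤ θ) (h : θ < θ')
    (hθ' : ∀ k j : ℕ, 1 / 3 ≤ |(j : ℝ) - θ' * 4 ^ k|) :
    ∃ w, rejectionRatio θ' w ≤ 1 / 2 ∧ 1 / 2 < rejectionRatio θ w := by
  obtain ⟨k, hk⟩ := pow_unbounded_of_one_lt (θ' - θ)⁻¹ (by norm_num : (1 : ℝ) < 4)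
  have hk : 1 < (θ' - θ) * 4 ^ k := by
    rwa [inv_lt_iff_one_lt_mul₀' (sub_pos.mpr h)] at hk
  -- An integer strictly between `θ 4^k` and `θ' 4^k`.
  set j := ⌊θ * 4 ^ k⌋₊ + 1 with hj
  have h1 : θ * 4 ^ k < j := by rw [hj]; push_cast; exact Nat.lt_floor_add_one _
  have h2 : (j : ℝ) ≤ θ * 4 ^ k + 1 := by
    rw [hj]; push_cast; linarith [Nat.floor_le (show 0 ≤ θ * 4 ^ k by positivity)]
  refine ⟨List.replicate j false ++ true :: powerChain k, ?_, ?_⟩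
  · rw [rejectionRatio_powerChain]
    rcases le_abs'.mp (hθ' k j) with h3 | h3
    · linarith [exp_le_quarter h3]
    · linarith
  · rw [rejectionRatio_powerChain]
    linarith [Real.add_one_le_exp (18 * (j - θ * 4 ^ k))]

/-! ### Uncountably many slopes -/

/-- The number with the base-4 digits `1 + x i` after the point. -/
def digitSlope (x : ℕ → Bool) : ℝ := 1 / 3 + 1 / 4 * Cardinal.cantorFunction (1 / 4) x

theorem digitSlope_injective : Function.Injective digitSlope := fun x y h =>
  Cardinal.cantorFunction_injective (c := 1 / 4) (by norm_num) (by norm_num)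
    (by unfold digitSlope at h; linarith)

theorem digitSlope_mem_Icc (x : ℕ → Bool) : digitSlope x ∈ Set.Icc (1 / 3 : ℝ) (2 / 3) := by
  have h0 : 0 ≤ Cardinal.cantorFunction (1 / 4) x :=
    tsum_nonneg fun n => Cardinal.cantorFunctionAux_nonneg (by norm_num)
  have h1 : Cardinal.cantorFunction (1 / 4) x ≤ Cardinal.cantorFunction (1 / 4) fun _ => true :=
    Cardinal.cantorFunction_le (by norm_num) (by norm_num) (by simp)
  have h2 : Cardinal.cantorFunction (1 / 4) (fun _ => true) = 4 / 3 := by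
    have := Cardinal.cantorFunction_succ (c := 1 / 4) (fun _ => true) (by norm_num) (by norm_num)
    simp only [cond_true] at this
    linarith
  constructor <;> unfold digitSlope <;> linarith

theorem exists_digitSlope_mul_pow (k : ℕ) (x : ℕ → Bool) :
    ∃ (m : ℤ) (y : ℕ → Bool), digitSlope x * 4 ^ k = m + digitSlope y := by
  induction k with
  | zero => exact ⟨0, x, by simp⟩
  | succ k ih =>
    obtain ⟨m, y, h⟩ := ih
    have hy := Cardinal.cantorFunction_succ (c := 1 / 4) y (by norm_num) (by norm_num)
    refine ⟨4 * m + 1 + cond (y 0) 1 0, fun n => y (n + 1), ?_⟩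
    rw [pow_succ, ← mul_assoc, h]
    unfold digitSlope
    rw [hy]
    cases y 0 <;> push_cast <;> simp only [cond_true, cond_false] <;> push_cast <;> ring

/-- The digits `0` and `3` do not occur, so a shifted expansion stays away from the integers. -/
theorem third_le_abs_sub_digitSlope (x : ℕ → Bool) (k j : ℕ) :
    1 / 3 ≤ |(j : ℝ) - digitSlope x * 4 ^ k| := by
  obtain ⟨m, y, h⟩ := exists_digitSlope_mul_pow k x
  obtain ⟨h1, h2⟩ := digitSlope_mem_Icc y
  rw [h, le_abs']
  rcases le_or_gt (j : ℤ) m with hm | hm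
  · left
    have : (j : ℝ) ≤ m := by exact_mod_cast hm
    linarith
  · right
    have : (m : ℝ) + 1 ≤ j := by exact_mod_cast hm
    linarith

/-- The words on which `rejectionRatio (digitSlope x)` is small. -/
def slopeLanguage (x : ℕ → Bool) : Language Bool :=
  ({w | rejectionRatio (digitSlope x) w ≤ 1 / 2} : Set (List Bool))

theorem slopeLanguage_injective : Function.Injective slopeLanguage := by
  have key : ∀ x y, digitSlope x < digitSlope y → slopeLanguage x ≠ slopeLanguage y := by
    intro x y hlt heq
    obtain ⟨w, h1, h2⟩ := exists_rejectionRatio_lt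
      (by linarith [(digitSlope_mem_Icc x).1]) hlt (third_le_abs_sub_digitSlope y)
    have h3 : w ∈ slopeLanguage y := h1
    rw [← heq] at h3
    exact absurd h3 (not_le.mpr h2)
  intro x y h
  refine digitSlope_injective ?_
  rcases lt_trichotomy (digitSlope x) (digitSlope y) with hlt | heq | hgt
  · exact absurd h (key x y hlt)
  · exact heq
  · exact absurd h.symm (key y x hgt)

end

theorem mainTheorem3 (f : ℕ → ℕ) (hf : ¬ BddAbove (Set.range f)) :
    ¬ {L : Language Bool | RecognizedByPostPCAInSpace L f}.Countable := by
  intro hc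
  have hsub : Set.range slopeLanguage ⊆ {L : Language Bool | RecognizedByPostPCAInSpace L f} := by
    rintro _ ⟨x, rfl⟩
    exact (isNonnegRational_rejectionRatio _).recognized
      (rejectionRatio_gap (third_le_abs_sub_digitSlope x)) f
  have hcount : Countable (Set.range slopeLanguage) := (hc.mono hsub).to_subtype
  have : Countable (ℕ → Bool) :=
    (Equiv.ofInjective _ slopeLanguage_injective).injective.countable
  obtain ⟨e, he⟩ := exists_surjective_nat (ℕ → Bool)
  obtain ⟨n, hn⟩ := he fun n => !(e n n)
  simpa using congrFun hn n
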